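/- Let $\mathbb F_q$ be a finite field and $C\subseteq\mathbb F_q^n$ a linear code of dimension $k$. Its hull is $H(C)=C\cap C^\perp$, where $C^\perp$ is the dual for the standard inner product $\sum_i a_ib_i$; put $h=\dim H(C)$. Two codes $C_1,C_2\subseteq\mathbb F_q^n$ are monomially equivalent if $M(C_1)=C_2$ for a monomial matrix $M$, i.e. a square matrix with exactly one nonzero entry in every row and every column. Let $A_w$ be the number of codewords of $C$ of Hamming weight $w$ and $W_C(X,Y)=\sum_{w=0}^n A_wX^{n-w}Y^w$ the weight enumerator. The extended weight enumerator is $$W_C(X,Y,T)=X^n+\sum_{t=0}^n B_t(T)(X-Y)^tY^{n-t},\qquad B_t(T)=\sum_{|J|=t}\bigl(T^{\dim C(J)}-1\bigr),$$ where $J$ runs over the $t$-element subsets of $\{1,\dots,n\}$ and $C(J)=\{c\in C: c_i=0 \text{ for all } i\in J\}$. Let $t_C(X,Y)=\sum_{A\subseteq\{1,\dots,n\}}(X-1)^{r(E)-r(A)}(Y-1)^{|A|-r(A)}$ be the Tutte polynomial of the matroid $M(C)$ on $E=\{1,\dots,n\}$, whose independent sets are the sets of positions at which the columns of a generator matrix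 of $C$ are linearly independent; $r$ is its rank function. 1. (Any $q$.) One has $W_C(X,Y,q)=W_C(X,Y)$ and $$W_C(X,Y,T)=(X-Y)^kY^{n-k}\,t_C\!\left(\frac{X+(T-1)Y}{X-Y},\frac XY\right),$$ $$t_C(X,Y)=Y^n(Y-1)^{-k}\,W_C\bigl(1,Y^{-1},(X-1)(Y-1)\bigr),$$ the last two whenever the denominators are nonzero, the variables taking values in an arbitrary field. 2. (Binary codes, $q=2$.) Monomially equivalent codes have hulls of the same dimension; codes (of possibly different lengths) with the same extended weight enumerator have hulls of the same dimension; and $$|t_C(-1,-1)|=2^h,\qquad |W_C(1,-1,4)|=2^k\,|t_C(-1,-1)|=2^{k+h}.$$ 3. (Ternary codes, $q=3$.) Monomially equivalent codes have hulls of the same dimension; codes (of possibly different lengths) with the same extended weight enumerator, or only with the same weight enumerator $W_C(X,Y)$, have hulls of the same dimension; and for every primitive cube root of unity $j\in\mathbb C$, $$|t_C(j,j^2)|=(\sqrt3)^h,\qquad t_C(j,j^2)=j^{2n}(j^2-1)^{-k}\,W_C(1,j),\qquad |W_C(1,j)|=(\sqrt3)^{k+h},$$ $$W_C(1,j)=a_0+a_1j+a_2j^2,\qquad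 a_r=\sum_{i=0}^{\lfloor n/3\rfloor}A_{3i+r}\quad(r=0,1,2),$$ with $A_w=0$ for $w>n$. -/

import Mathlib

namespace HullCode

noncomputable section

section Codes

variable {F : Type*} [Field F] {n : ℕ}

/-- The dual of a linear code for the standard inner product. -/
def dualCode (C : Submodule F (Fin n → F)) : Submodule F (Fin n → F) where
  carrier := {x | ∀ c ∈ C, ∑ i, x i * c i = 0}
  zero_mem' := by intro c _; simp
  add_mem' := by
    intro x y hx hy c hc
    have h1 := hx c hc
    have h2 := hy c hc
    simp only [Pi.add_apply, add_mul, Finset.sum_add_distrib, h1, h2, add_zero]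
  smul_mem' := by
    intro a x hx c hc
    have h1 := hx c hc
    simp only [Pi.smul_apply, smul_eq_mul, mul_assoc, ← Finset.mul_sum, h1, mul_zero]

/-- The hull `C ∩ C^⊥`. -/
def hull (C : Submodule F (Fin n → F)) : Submodule F (Fin n → F) := C ⊓ dualCode C

/-- The dimension of the code. -/
def dimCode (C : Submodule F (Fin n → F)) : ℕ := Module.finrank F C

/-- A monomial matrix: exactly one nonzero element in every row and in every column. -/
def IsMonomialMatrix (M : Matrix (Fin n) (Fin n) F) : Prop :=
  (∀ i, ∃! j, M i j ≠ 0) ∧ (∀ j, ∃! i, M i j ≠ 0)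

/-- Monomial equivalence of two codes of the same length: `M(C₁) = C₂` for a monomial matrix. -/
def MonomialEquivalent (C₁ C₂ : Submodule F (Fin n → F)) : Prop :=
  ∃ M : Matrix (Fin n) (Fin n) F, IsMonomialMatrix M ∧ C₁.map M.mulVecLin = C₂

/-- `A_w`, the number of codewords of Hamming weight `w`. -/
def weightDist [DecidableEq F] (C : Submodule F (Fin n → F)) (w : ℕ) : ℕ :=
  Set.ncard {c : Fin n → F | c ∈ C ∧ hammingNorm c = w}

/-- The weight enumerator `W_C(X, Y) = ∑ A_w X^(n-w) Y^w`, with `X = X 0` and `Y = X 1`. -/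
def weightEnum [DecidableEq F] (C : Submodule F (Fin n → F)) : MvPolynomial (Fin 2) ℤ :=
  ∑ w ∈ Finset.range (n + 1), (weightDist C w : MvPolynomial (Fin 2) ℤ) *
    MvPolynomial.X 0 ^ (n - w) * MvPolynomial.X 1 ^ w

/-- `C(J)`: the codewords of `C` that vanish on all positions in `J`. -/
def vanishingOn (C : Submodule F (Fin n → F)) (J : Finset (Fin n)) :
    Submodule F (Fin n → F) where
  carrier := {c | c ∈ C ∧ ∀ j ∈ J, c j = 0}
  zero_mem' := ⟨C.zero_mem, fun _ _ => rfl⟩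
  add_mem' := by
    rintro x y ⟨hx, hx'⟩ ⟨hy, hy'⟩
    exact ⟨C.add_mem hx hy, fun j hj => by simp [hx' j hj, hy' j hj]⟩
  smul_mem' := by
    rintro a x ⟨hx, hx'⟩
    exact ⟨C.smul_mem a hx, fun j hj => by simp [hx' j hj]⟩

/-- `B_t(T) = ∑_{|J| = t} (T^(dim C(J)) - 1)`, with `T = X 2`. -/
def extB (C : Submodule F (Fin n → F)) (t : ℕ) : MvPolynomial (Fin 3) ℤ :=
  ∑ J ∈ (Finset.univ : Finset (Fin n)).powersetCard t,
    (MvPolynomial.X 2 ^ Module.finrank F (vanishingOn C J) - 1)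

/-- The extended weight enumerator
`W_C(X, Y, T) = X^n + ∑_{t=0}^{n} B_t(T) (X - Y)^t Y^(n-t)`,
with `X = X 0`, `Y = X 1` and `T = X 2`. -/
def extWeightEnum (C : Submodule F (Fin n → F)) : MvPolynomial (Fin 3) ℤ :=
  MvPolynomial.X 0 ^ n + ∑ t ∈ Finset.range (n + 1), extB C t *
    (MvPolynomial.X 0 - MvPolynomial.X 1) ^ t * MvPolynomial.X 1 ^ (n - t)

end Codes

section Matroids

/-- The linear matroid of a finite family of vectors: a set of indices is independent when
the corresponding subfamily is linearly independent. -/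
def linearMatroid (F : Type*) [Field F] {V : Type*} [AddCommGroup V] [Module F V]
    {α : Type*} [Finite α] (v : α → V) : Matroid α :=
  (IndepMatroid.ofFinite (E := Set.univ) Set.finite_univ
    (fun I => LinearIndepOn F v I)
    (linearIndepOn_empty F v)
    (fun _ _ hJ hIJ => hJ.mono hIJ)
    (by
      intro I J hI hJ hIJ
      by_contra hcon
      push Not at hcon
      have hmem : ∀ e ∈ J, v e ∈ Submodule.span F (v '' I) := by
        intro e he
        by_cases heI : e ∈ I
        · exact Submodule.subset_span ⟨e, heI, rfl⟩
        · by_contra hns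
          exact hcon e he heI (hI.insert hns)
      have hfin : (v '' I).Finite := (Set.toFinite I).image v
      have : FiniteDimensional F (Submodule.span F (v '' I)) :=
        FiniteDimensional.span_of_finite F hfin
      have hle : Submodule.span F (v '' J) ≤ Submodule.span F (v '' I) := by
        rw [Submodule.span_le]
        rintro _ ⟨e, he, rfl⟩
        exact hmem e he
      have hdim : ∀ K : Set α, LinearIndepOn F v K →
          Module.finrank F (Submodule.span F (v '' K)) = K.ncard := by
        intro K hK
        have : Fintype K := Fintype.ofFinite K
        have h := finrank_span_eq_card (R := F) (b := fun x : K => v x) hK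
        rw [Set.image_eq_range, h, Set.ncard_eq_toFinset_card', Set.toFinset_card]
      have := Submodule.finrank_mono hle
      rw [hdim I hI, hdim J hJ] at this
      omega)
    (fun _ _ => Set.subset_univ _)).matroid

/-- The matroid `M(C)` of a code `C`: the linear matroid on the positions given by the coordinate
functionals on `C` (see `codeMatroid_indep_iff_generator` for generator matrices). -/
def codeMatroid {F : Type*} [Field F] {n : ℕ} (C : Submodule F (Fin n → F)) :
    Matroid (Fin n) :=
  linearMatroid F (fun i => ((LinearMap.proj i : (Fin n → F) →ₗ[F] F).comp C.subtype))

/-- For any matrix `G` whose rows span `C`, the set `I` is independent in `M(C)` if and only if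
the columns of `G` at the positions in `I` are linearly independent. -/
theorem codeMatroid_indep_iff_generator {F : Type*} [Field F] {n k : ℕ}
    (C : Submodule F (Fin n → F)) (G : Matrix (Fin k) (Fin n) F)
    (hG : Submodule.span F (Set.range G.row) = C) (I : Set (Fin n)) :
    (codeMatroid C).Indep I ↔ LinearIndepOn F G.col I := by
  have hrow : ∀ a, G.row a ∈ C := fun a => hG ▸ Submodule.subset_span ⟨a, rfl⟩
  let φ : (C →ₗ[F] F) →ₗ[F] (Fin k → F) :=
    { toFun := fun f a => f ⟨G.row a, hrow a⟩
      map_add' := fun _ _ => rfl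
      map_smul' := fun _ _ => rfl }
  have hφ : LinearMap.ker φ = ⊥ := by
    rw [LinearMap.ker_eq_bot']
    intro f hf
    have key : ∀ x (hx : x ∈ Submodule.span F (Set.range G.row)), f ⟨x, hG ▸ hx⟩ = 0 := by
      intro x hx
      induction hx using Submodule.span_induction with
      | mem x h =>
        obtain ⟨a, rfl⟩ := h
        exact congrFun hf a
      | zero => exact f.map_zero
      | add x y hx hy h1 h2 =>
        have := f.map_add ⟨x, hG ▸ hx⟩ ⟨y, hG ▸ hy⟩
        rw [h1, h2, add_zero] at this
        exact this
      | smul a x hx h1 =>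
        have := f.map_smul a ⟨x, hG ▸ hx⟩
        rw [h1, smul_zero] at this
        exact this
    ext ⟨x, hx⟩
    exact key x (hG.symm ▸ hx)
  exact (LinearMap.linearIndependent_iff φ hφ).symm

open Classical in
/-- The Tutte polynomial
`t_M(X, Y) = ∑_{A ⊆ E} (X - 1)^(r(E) - r(A)) (Y - 1)^(|A| - r(A))`,
with `X = X 0` and `Y = X 1`. -/
def tuttePoly {α : Type*} [Fintype α] (M : Matroid α) : MvPolynomial (Fin 2) ℤ :=
  ∑ A ∈ (Finset.univ : Finset (Finset α)).filter (fun A : Finset α => (A : Set α) ⊆ M.E),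
    (MvPolynomial.X 0 - 1) ^ (M.eRank.toNat - (M.eRk (A : Set α)).toNat) *
      (MvPolynomial.X 1 - 1) ^ (A.card - (M.eRk (A : Set α)).toNat)

end Matroids

end

end HullCode

/-! Both polynomials are sums over sets `J` of positions, and r(J) + dim C(J) = k matches them term
by term, giving the two substitution formulas. At T = q^m the power T^(dim C(J)) counts m-tuples of
codewords vanishing on J, so exchanging sums turns W_C into a sum over C^m; m = 1 is the ordinary
weight enumerator.

The hull enters through quadratic Gauss sums: if f is unimodular with polarization b and f = 1 on
the radical of b, then |∑ f|² = |V| · |rad| (`normSq_sum_quadratic`). Over F_3 nonzero squares are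
1, so W_C(1, j) is the Gauss sum of ∑ cᵢ² on C, whose radical is the hull: |W_C(1, j)|² = 3^(k+h).
Over F_2 the form ∑ cᵢ² is additive, with zero polarization, so one passes to pairs: a² + ab + b² is
1 off the origin, W_C(1, -1, 4) is its Gauss sum on C × C, and the radical is H × H.

Evaluating at X = Y = 1 gives T^k; knowing k and k + h determines h, whatever the lengths. Monomial
equivalence preserves h because monomial matrices over F_2 and F_3 are orthogonal. -/

namespace HullCode

/-! ### Rank function of M(C) and dimensions of vanishing subcodes -/

section Rank

variable {F : Type*} [Field F] {n : ℕ}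

theorem linearMatroid_eRk_toNat {V : Type*} [AddCommGroup V] [Module F V]
    {α : Type*} [Finite α] (v : α → V) (A : Set α) :
    ((linearMatroid F v).eRk A).toNat = Module.finrank F (Submodule.span F (v '' A)) := by
  obtain ⟨I, hI⟩ := (linearMatroid F v).exists_isBasis A (Set.subset_univ A)
  have hind : LinearIndepOn F v I := hI.indep
  have hspan : Submodule.span F (v '' A) = Submodule.span F (v '' I) := by
    apply le_antisymm _ (Submodule.span_mono (Set.image_mono hI.subset))
    rw [Submodule.span_le]
    rintro _ ⟨e, he, rfl⟩
    by_contra hns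
    have heI : e ∈ I := hI.mem_of_insert_indep he (hind.insert hns)
    exact hns (Submodule.subset_span ⟨e, heI, rfl⟩)
  have : Fintype I := Fintype.ofFinite I
  have h := finrank_span_eq_card (R := F) (b := fun x : I => v x) hind
  rw [hspan, ← hI.encard_eq_eRk, Set.image_eq_range, h, ← Nat.card_eq_fintype_card]
  rfl

/-- The rank of a set of positions is the codimension of the subcode vanishing there. -/
theorem codeMatroid_eRk_add_finrank_vanishingOn (C : Submodule F (Fin n → F))
    (J : Finset (Fin n)) :
    ((codeMatroid C).eRk (J : Set (Fin n))).toNat + Module.finrank F (vanishingOn C J) =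
      dimCode C := by
  rw [codeMatroid, linearMatroid_eRk_toNat, dimCode,
    ← Subspace.finrank_add_finrank_dualCoannihilator_eq (Submodule.span F
      ((fun i => ((LinearMap.proj i : (Fin n → F) →ₗ[F] F).comp C.subtype)) '' (J : Set (Fin n))))]
  congr 1
  -- C(J) is the common kernel on C of the coordinate functionals in J, hence the coannihilator of
  -- their span, whose dimension is complementary to the rank.
  have hmap : vanishingOn C J = ((Submodule.span F
      ((fun i => ((LinearMap.proj i : (Fin n → F) →ₗ[F] F).comp C.subtype)) ''
        (J : Set (Fin n)))).dualCoannihilator).map C.subtype := by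
    ext c
    rw [Submodule.mem_map]
    constructor
    · rintro ⟨hc, h⟩
      refine ⟨⟨c, hc⟩, ?_, rfl⟩
      rw [← SetLike.mem_coe, Submodule.coe_dualCoannihilator_span]
      rintro _ ⟨i, hi, rfl⟩
      exact h i hi
    · rintro ⟨⟨c, hc⟩, h, rfl⟩
      rw [← SetLike.mem_coe, Submodule.coe_dualCoannihilator_span] at h
      exact ⟨hc, fun i hi => h _ ⟨i, hi, rfl⟩⟩
  rw [hmap]
  exact (Submodule.equivMapOfInjective C.subtype C.injective_subtype _).finrank_eq.symm

theorem codeMatroid_eRank_toNat (C : Submodule F (Fin n → F)) :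
    (codeMatroid C).eRank.toNat = dimCode C := by
  rw [← codeMatroid_eRk_add_finrank_vanishingOn C Finset.univ, Finset.coe_univ,
    Matroid.eRk_univ_eq]
  have : vanishingOn C Finset.univ = ⊥ := by
    rw [eq_bot_iff]
    rintro c ⟨-, h⟩
    exact funext fun i => h i (Finset.mem_univ i)
  rw [this, finrank_bot, add_zero]

theorem codeMatroid_eRk_toNat_le_card (C : Submodule F (Fin n → F)) (J : Finset (Fin n)) :
    ((codeMatroid C).eRk (J : Set (Fin n))).toNat ≤ J.card := by
  have h := (codeMatroid C).eRk_le_encard (J : Set (Fin n))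
  rw [Set.encard_coe_eq_coe_finsetCard] at h
  simpa using ENat.toNat_le_toNat h (ENat.natCast_ne_top _)

theorem dimCode_le_length (C : Submodule F (Fin n → F)) : dimCode C ≤ n := by
  simpa [dimCode] using C.finrank_le

end Rank

/-! ### The enumerators as sums over position sets and over codewords -/

section Enumerators

variable {F : Type*} [Field F] {n : ℕ} {K : Type*} [CommRing K]

/-- By the binomial theorem the terms -1 in the B_t add up to -((x - y) + y)^n = -x^n, which cancels
the leading x^n. -/
theorem aeval_extWeightEnum (C : Submodule F (Fin n → F)) (x y T : K) :
    MvPolynomial.aeval ![x, y, T] (extWeightEnum C) =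
      ∑ J : Finset (Fin n), T ^ Module.finrank F (vanishingOn C J) *
        ((x - y) ^ J.card * y ^ (n - J.card)) := by
  have h0 : ∑ t ∈ Finset.range (n + 1), (∑ J ∈ (Finset.univ : Finset (Fin n)).powersetCard t,
        (T ^ Module.finrank F (vanishingOn C J) - 1)) * (x - y) ^ t * y ^ (n - t) =
      ∑ J : Finset (Fin n), (T ^ Module.finrank F (vanishingOn C J) - 1) *
        ((x - y) ^ J.card * y ^ (n - J.card)) := by
    have h := Finset.sum_powerset (s := (Finset.univ : Finset (Fin n)))
      (f := fun J => (T ^ Module.finrank F (vanishingOn C J) - 1) *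
        ((x - y) ^ J.card * y ^ (n - J.card)))
    rw [Finset.powerset_univ, Finset.card_univ, Fintype.card_fin] at h
    rw [h]
    refine Finset.sum_congr rfl fun t _ => ?_
    rw [mul_assoc, Finset.sum_mul]
    refine Finset.sum_congr rfl fun J hJ => ?_
    rw [(Finset.mem_powersetCard.1 hJ).2]
  have h1 := Fin.sum_pow_mul_eq_add_pow (n := n) (x - y) y
  simp only [extWeightEnum, extB, map_add, map_sum, map_mul, map_pow, map_sub, map_one,
    MvPolynomial.aeval_X, Matrix.cons_val_zero, Matrix.cons_val_one, Matrix.cons_val]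
  rw [h0]
  simp only [sub_mul, one_mul, Finset.sum_sub_distrib]
  rw [h1, sub_add_cancel, add_sub_cancel]

theorem aeval_tuttePoly_codeMatroid (C : Submodule F (Fin n → F)) (x y : K) :
    MvPolynomial.aeval ![x, y] (tuttePoly (codeMatroid C)) =
      ∑ J : Finset (Fin n), (x - 1) ^ Module.finrank F (vanishingOn C J) *
        (y - 1) ^ (J.card - ((codeMatroid C).eRk (J : Set (Fin n))).toNat) := by
  have hE : (codeMatroid C).E = Set.univ := rfl
  simp only [tuttePoly, hE, Set.subset_univ, Finset.filter_true, map_sum, map_mul, map_pow,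
    map_sub, map_one, MvPolynomial.aeval_X, Matrix.cons_val_zero, Matrix.cons_val_one]
  refine Finset.sum_congr rfl fun J _ => ?_
  rw [codeMatroid_eRank_toNat, ← codeMatroid_eRk_add_finrank_vanishingOn C J,
    Nat.add_sub_cancel_left]

/-- Exchange the sums; for fixed `v` the sets `J ⊆ Z v` contribute by the binomial theorem for (x -
y) + y. It is applied with `Z v` the zero positions of a codeword (T = q) or of a pair of codewords
(T = q²). -/
theorem sum_card_vanishing_mul {V : Type*} [Fintype V] (Z : V → Finset (Fin n)) (x y : K) :
    ∑ J : Finset (Fin n), ((Finset.univ.filter fun v => J ⊆ Z v).card : K) *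
        ((x - y) ^ J.card * y ^ (n - J.card)) =
      ∑ v, x ^ (Z v).card * y ^ (n - (Z v).card) := by
  have h : ∀ v, ∑ J : Finset (Fin n), (if J ⊆ Z v then (x - y) ^ J.card * y ^ (n - J.card)
      else 0) = x ^ (Z v).card * y ^ (n - (Z v).card) := by
    intro v
    rw [← Finset.sum_filter, show (Finset.univ.filter fun J => J ⊆ Z v) = (Z v).powerset by
      ext J; simp]
    conv_rhs => rw [← sub_add_cancel x y, ← Finset.sum_pow_mul_eq_add_pow, Finset.sum_mul]
    refine Finset.sum_congr rfl fun J hJ => ?_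
    have h1 := Finset.card_le_card (Finset.mem_powerset.1 hJ)
    have h2 : (Z v).card ≤ n := by simpa using (Z v).card_le_univ
    rw [mul_assoc, ← pow_add]
    congr 2
    omega
  simp_rw [← h]
  rw [Finset.sum_comm]
  refine Finset.sum_congr rfl fun J _ => ?_
  rw [Finset.card_filter, Nat.cast_sum, Finset.sum_mul]
  refine Finset.sum_congr rfl fun v _ => ?_
  split_ifs <;> simp

theorem aeval_weightEnum [DecidableEq F] (C : Submodule F (Fin n → F)) [Fintype C] (x y : K) :
    MvPolynomial.aeval ![x, y] (weightEnum C) =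
      ∑ c : C, x ^ (n - hammingNorm (c : Fin n → F)) * y ^ hammingNorm (c : Fin n → F) := by
  have hw : ∀ w, weightDist C w =
      (Finset.univ.filter fun c : C => hammingNorm (c : Fin n → F) = w).card := by
    intro w
    rw [weightDist, ← Nat.card_coe_set_eq, ← Fintype.card_subtype, ← Nat.card_eq_fintype_card]
    exact Nat.card_congr (Equiv.subtypeSubtypeEquivSubtypeInter (· ∈ C)
      fun c : Fin n → F => hammingNorm c = w).symm
  simp only [weightEnum, map_sum, map_mul, map_pow, map_natCast,
    MvPolynomial.aeval_X, Matrix.cons_val_zero, Matrix.cons_val_one]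
  rw [← Finset.sum_fiberwise_of_maps_to (t := Finset.range (n + 1))
    (g := fun c : C => hammingNorm (c : Fin n → F))]
  · refine Finset.sum_congr rfl fun w _ => ?_
    rw [hw, Finset.sum_congr rfl (g := fun _ => x ^ (n - w) * y ^ w)]
    · rw [Finset.sum_const, nsmul_eq_mul, mul_assoc]
    · intro c hc
      rw [(Finset.mem_filter.1 hc).2]
  · intro c _
    have h := hammingNorm_le_card_fintype (x := (c : Fin n → F))
    rw [Fintype.card_fin] at h
    exact Finset.mem_range.2 (Nat.lt_succ_of_le h)

variable [Fintype F]

theorem card_vanishingOn (C : Submodule F (Fin n → F)) (J : Finset (Fin n)) :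
    Nat.card {c : C // ∀ j ∈ J, (c : Fin n → F) j = 0} =
      Fintype.card F ^ Module.finrank F (vanishingOn C J) := by
  rw [← Nat.card_eq_fintype_card, ← Module.natCard_eq_pow_finrank]
  exact Nat.card_congr
    (Equiv.subtypeSubtypeEquivSubtypeInter (· ∈ C) fun c : Fin n → F => ∀ j ∈ J, c j = 0)

theorem card_vanishingOn_sq (C : Submodule F (Fin n → F)) (J : Finset (Fin n)) :
    Nat.card {v : C × C // ∀ j ∈ J, (v.1 : Fin n → F) j = 0 ∧ (v.2 : Fin n → F) j = 0} =
      (Fintype.card F ^ 2) ^ Module.finrank F (vanishingOn C J) := by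
  rw [pow_right_comm, sq, ← card_vanishingOn, ← Nat.card_prod]
  refine Nat.card_congr ((Equiv.subtypeEquivRight fun v => ?_).trans Equiv.subtypeProdEquivProd)
  exact ⟨fun h => ⟨fun j hj => (h j hj).1, fun j hj => (h j hj).2⟩,
    fun h j hj => ⟨h.1 j hj, h.2 j hj⟩⟩

theorem aeval_extWeightEnum_card [DecidableEq F] (C : Submodule F (Fin n → F)) (x y : K) :
    MvPolynomial.aeval ![x, y, (Fintype.card F : K)] (extWeightEnum C) =
      MvPolynomial.aeval ![x, y] (weightEnum C) := by
  have : Fintype C := Fintype.ofFinite C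
  rw [aeval_weightEnum, aeval_extWeightEnum]
  have h := sum_card_vanishing_mul
    (fun c : C => Finset.univ.filter fun i => (c : Fin n → F) i = 0) x y
  have hz : ∀ c : C, (Finset.univ.filter fun i => (c : Fin n → F) i = 0).card =
      n - hammingNorm (c : Fin n → F) := by
    intro c
    have := Finset.card_filter_add_card_filter_not (s := (Finset.univ : Finset (Fin n)))
      (fun i => (c : Fin n → F) i = 0)
    rw [Finset.card_univ, Fintype.card_fin] at this
    simp only [hammingNorm, ne_eq]
    omega
  have hle : ∀ c : C, hammingNorm (c : Fin n → F) ≤ n := fun c => by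
    simpa using hammingNorm_le_card_fintype (x := (c : Fin n → F))
  simp only [hz, Nat.sub_sub_self (hle _)] at h
  rw [← h]
  refine Finset.sum_congr rfl fun J _ => ?_
  rw [← Nat.cast_pow, ← card_vanishingOn, Nat.card_eq_fintype_card, Fintype.card_subtype]
  simp only [Finset.subset_iff, Finset.mem_filter, Finset.mem_univ, true_and]

end Enumerators

/-! ### Substitutions between W_C and the Tutte polynomial -/

section Tutte

variable {F : Type*} [Field F] {n : ℕ} {K : Type*} [Field K]

theorem aeval_extWeightEnum_eq_tuttePoly (C : Submodule F (Fin n → F)) (x y T : K)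
    (hxy : x ≠ y) (hy : y ≠ 0) :
    MvPolynomial.aeval ![x, y, T] (extWeightEnum C) =
      (x - y) ^ dimCode C * y ^ (n - dimCode C) *
        MvPolynomial.aeval ![(x + (T - 1) * y) / (x - y), x / y] (tuttePoly (codeMatroid C)) := by
  have hs : x - y ≠ 0 := sub_ne_zero.2 hxy
  rw [aeval_extWeightEnum, aeval_tuttePoly_codeMatroid, Finset.mul_sum]
  refine Finset.sum_congr rfl fun J _ => ?_
  have h1 := codeMatroid_eRk_add_finrank_vanishingOn C J
  have h2 := codeMatroid_eRk_toNat_le_card C J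
  have h3 := dimCode_le_length C
  have h4 : J.card ≤ n := by simpa using J.card_le_univ
  rw [show (x + (T - 1) * y) / (x - y) - 1 = T * y / (x - y) by field_simp; ring,
    show x / y - 1 = (x - y) / y by field_simp]
  generalize ((codeMatroid C).eRk (J : Set (Fin n))).toNat = r at *
  generalize Module.finrank F (vanishingOn C J) = d at *
  obtain ⟨a, ha⟩ := Nat.exists_eq_add_of_le h2
  rw [ha, Nat.add_sub_cancel_left, ← h1, div_pow, div_pow, mul_pow, pow_add, pow_add]
  -- Both exponents equal n - r; the truncated subtractions are exact because r + d = k ≤ n and r +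
  -- a = |J| ≤ n.
  have e : y ^ (n - (r + d)) * y ^ d = y ^ (n - (r + a)) * y ^ a := by
    rw [← pow_add, ← pow_add]
    congr 1
    omega
  field_simp
  linear_combination (-T ^ d) * e

/-- This is the previous formula at (1, y⁻¹), with T chosen so that the first Tutte argument becomes
x. -/
theorem aeval_tuttePoly_eq_extWeightEnum (C : Submodule F (Fin n → F)) (x y : K)
    (hy : y ≠ 0) (hy1 : y ≠ 1) :
    MvPolynomial.aeval ![x, y] (tuttePoly (codeMatroid C)) =
      y ^ n * ((y - 1) ^ dimCode C)⁻¹ *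
        MvPolynomial.aeval ![1, y⁻¹, (x - 1) * (y - 1)] (extWeightEnum C) := by
  have hs : y - 1 ≠ 0 := sub_ne_zero.2 hy1
  rw [aeval_extWeightEnum_eq_tuttePoly C 1 y⁻¹ _ (by simpa [eq_comm] using hy1) (inv_ne_zero hy),
    show (1 + ((x - 1) * (y - 1) - 1) * y⁻¹) / (1 - y⁻¹) = x by
      rw [show (1 - y⁻¹) = (y - 1) / y by field_simp]; field_simp; ring,
    one_div, inv_inv, show (1 - y⁻¹) = (y - 1) / y by field_simp, div_pow, inv_pow]
  obtain ⟨a, ha⟩ := Nat.exists_eq_add_of_le (dimCode_le_length C)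
  rw [show n - dimCode C = a by omega, show y ^ n = y ^ dimCode C * y ^ a by rw [← pow_add, ← ha]]
  field_simp

end Tutte



/-! ### Quadratic Gauss sums and faithful additive characters -/

section GaussSums

open Classical in
/-- The absolute value of the Gauss sum of a quadratic function `f` with polarization `b`
that is trivial on its radical. -/
theorem normSq_sum_quadratic {V : Type*} [AddCommGroup V] [Fintype V] (f : V → ℂ)
    (b : V → AddChar V ℂ) (hf : ∀ v, ‖f v‖ = 1) (hadd : ∀ v d, f (v + d) = f v * f d * b d v)
    (hrad : ∀ d, b d = 0 → f d = 1) :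
    ‖∑ v, f v‖ ^ 2 = Nat.card V * Nat.card {d : V // b d = 0} := by
  have hconj : ∀ v, f v * (starRingEnd ℂ) (f v) = 1 := fun v => by
    rw [Complex.mul_conj', hf]; norm_num
  -- Write one summation index as v + d: by unimodularity f(v + d) times the conjugate of f(v) is
  -- f(d) b_d(v). Summing over v, orthogonality of characters keeps only the radical, where f = 1.
  have key : (∑ v, f v) * (starRingEnd ℂ) (∑ v, f v) =
      Nat.card V * Nat.card {d : V // b d = 0} := by
    calc (∑ v, f v) * (starRingEnd ℂ) (∑ v, f v)
        = ∑ v, ∑ d, f (v + d) * (starRingEnd ℂ) (f v) := by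
          rw [map_sum, Finset.mul_sum]
          refine Finset.sum_congr rfl fun v _ => ?_
          rw [← Finset.sum_mul]
          congr 1
          exact (Equiv.sum_comp (Equiv.addLeft v) f).symm
      _ = ∑ d, f d * ∑ v, b d v := by
          rw [Finset.sum_comm]
          refine Finset.sum_congr rfl fun d _ => ?_
          rw [Finset.mul_sum]
          refine Finset.sum_congr rfl fun v _ => ?_
          rw [hadd]
          linear_combination (f d * b d v) * hconj v
      _ = ∑ d, if b d = 0 then (Fintype.card V : ℂ) else 0 := by
          refine Finset.sum_congr rfl fun d _ => ?_
          rw [AddChar.sum_eq_ite]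
          split_ifs with h
          · rw [hrad d h, one_mul]
          · rw [mul_zero]
      _ = Nat.card V * Nat.card {d : V // b d = 0} := by
          rw [← Finset.sum_filter, Finset.sum_const, nsmul_eq_mul, Nat.card_eq_fintype_card,
            Nat.card_eq_fintype_card, Fintype.card_subtype, mul_comm]
  rw [Complex.mul_conj'] at key
  exact_mod_cast key

theorem exists_addChar_of_card_prime {F : Type*} [Field F] [Fintype F] {p : ℕ} (hp : p.Prime)
    (hF : Fintype.card F = p) {ζ : ℂ} (hζ : IsPrimitiveRoot ζ p) :
    ∃ χ : AddChar F ℂ, χ 1 = ζ ∧ ∀ x, χ x = 1 → x = 0 := by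
  have : Fact p.Prime := ⟨hp⟩
  let e := ZMod.ringEquivOfPrime F hp hF
  refine ⟨(AddChar.zmodChar (C := ℂ) p hζ.pow_eq_one).compAddMonoidHom
    (e.symm : F →+* ZMod p).toAddMonoidHom, ?_, fun x hx => ?_⟩
  · change AddChar.zmodChar p hζ.pow_eq_one (e.symm 1) = ζ
    have := AddChar.zmodChar_apply' (C := ℂ) hζ.pow_eq_one 1
    rw [map_one]
    simpa using this
  · change AddChar.zmodChar p hζ.pow_eq_one (e.symm x) = 1 at hx
    rw [AddChar.zmodChar_apply, hζ.pow_eq_one_iff_dvd] at hx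
    have h0 := Nat.eq_zero_of_dvd_of_lt hx (ZMod.val_lt _)
    rw [ZMod.val_eq_zero] at h0
    simpa using h0

end GaussSums

/-! ### The hull as the radical of a form on the code -/

section Hull

variable {F : Type*} [Field F] {n : ℕ}

theorem sum_mul_eq_zero_of_mem_hull {C : Submodule F (Fin n → F)} {c d : Fin n → F}
    (hd : d ∈ hull C) (hc : c ∈ C) : ∑ i, d i * c i = 0 := hd.2 c hc

theorem card_mem_hull [Fintype F] (C : Submodule F (Fin n → F)) :
    Nat.card {d : C // (d : Fin n → F) ∈ hull C} = Fintype.card F ^ dimCode (hull C) := by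
  rw [dimCode, ← Nat.card_eq_fintype_card, ← Module.natCard_eq_pow_finrank]
  exact Nat.card_congr (Equiv.subtypeSubtypeEquivSubtype fun h => h.1)

theorem card_code [Fintype F] (C : Submodule F (Fin n → F)) :
    Nat.card C = Fintype.card F ^ dimCode C := by
  rw [dimCode, ← Nat.card_eq_fintype_card, ← Module.natCard_eq_pow_finrank]

/-- The additive character `c ↦ χ (∑ cᵢ aᵢ)` of a code. -/
def pairingChar (χ : AddChar F ℂ) (C : Submodule F (Fin n → F)) (a : Fin n → F) :
    AddChar C ℂ where
  toFun c := χ (∑ i, a i * (c : Fin n → F) i)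
  map_zero_eq_one' := by simp
  map_add_eq_mul' c d := by
    simp only [Submodule.coe_add, Pi.add_apply, mul_add, Finset.sum_add_distrib,
      AddChar.map_add_eq_mul]

theorem pairingChar_apply (χ : AddChar F ℂ) (C : Submodule F (Fin n → F)) (a : Fin n → F)
    (c : C) : pairingChar χ C a c = χ (∑ i, a i * (c : Fin n → F) i) := rfl

theorem pairingChar_eq_zero_iff {χ : AddChar F ℂ} (hχ : ∀ x, χ x = 1 → x = 0)
    (C : Submodule F (Fin n → F)) (a : Fin n → F) :
    pairingChar χ C a = 0 ↔ a ∈ dualCode C := by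
  rw [AddChar.eq_zero_iff]
  constructor
  · exact fun h c hc => hχ _ (h ⟨c, hc⟩)
  · intro h c
    rw [pairingChar_apply, h c c.2, AddChar.map_zero_eq_one]

/-- The polarization of ∑ cᵢ² is 2⟨c, d⟩; since 2 is invertible its radical in C is the hull, on
which the form itself vanishes. -/
theorem normSq_sum_char_sq [Fintype F] (h2 : (2 : F) ≠ 0) {χ : AddChar F ℂ}
    (hχ : ∀ x, χ x = 1 → x = 0) (C : Submodule F (Fin n → F)) [Fintype C] :
    ‖∑ c : C, χ (∑ i, (c : Fin n → F) i ^ 2)‖ ^ 2 =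
      (Fintype.card F : ℝ) ^ (dimCode C + dimCode (hull C)) := by
  have hb : ∀ d : C, pairingChar χ C ((2 : F) • (d : Fin n → F)) = 0 ↔
      (d : Fin n → F) ∈ hull C := by
    intro d
    rw [pairingChar_eq_zero_iff hχ, Submodule.smul_mem_iff _ h2]
    exact ⟨fun h => ⟨d.2, h⟩, fun h => h.2⟩
  rw [normSq_sum_quadratic _ (fun d : C => pairingChar χ C ((2 : F) • (d : Fin n → F)))]
  · rw [pow_add, card_code, Nat.card_congr (Equiv.subtypeEquivRight hb), card_mem_hull]
    push_cast
    rfl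
  · exact fun c => AddChar.norm_apply χ _
  · intro v d
    rw [pairingChar_apply, ← AddChar.map_add_eq_mul, ← AddChar.map_add_eq_mul,
      ← Finset.sum_add_distrib, ← Finset.sum_add_distrib]
    congr 1
    refine Finset.sum_congr rfl fun i _ => ?_
    simp only [Submodule.coe_add, Pi.add_apply, Pi.smul_apply, smul_eq_mul]
    ring
  · intro d hd
    have := sum_mul_eq_zero_of_mem_hull ((hb d).1 hd) d.2
    simp only [sq, this, AddChar.map_zero_eq_one]

/-- The additive character `(c, c') ↦ χ (∑ aᵢ cᵢ + ∑ a'ᵢ c'ᵢ)` of a product of codes. -/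
def pairingChar₂ (χ : AddChar F ℂ) (C : Submodule F (Fin n → F)) (a a' : Fin n → F) :
    AddChar (C × C) ℂ where
  toFun v := pairingChar χ C a v.1 * pairingChar χ C a' v.2
  map_zero_eq_one' := by simp
  map_add_eq_mul' v w := by
    simp only [Prod.fst_add, Prod.snd_add, AddChar.map_add_eq_mul]
    ring

theorem pairingChar₂_apply (χ : AddChar F ℂ) (C : Submodule F (Fin n → F)) (a a' : Fin n → F)
    (v : C × C) :
    pairingChar₂ χ C a a' v = pairingChar χ C a v.1 * pairingChar χ C a' v.2 := rfl

theorem pairingChar₂_eq_zero_iff {χ : AddChar F ℂ} (hχ : ∀ x, χ x = 1 → x = 0)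
    (C : Submodule F (Fin n → F)) (a a' : Fin n → F) :
    pairingChar₂ χ C a a' = 0 ↔ a ∈ dualCode C ∧ a' ∈ dualCode C := by
  simp only [← pairingChar_eq_zero_iff hχ, AddChar.eq_zero_iff, pairingChar₂_apply]
  refine ⟨fun h => ⟨fun c => ?_, fun c => ?_⟩, fun h v => by rw [h.1, h.2, one_mul]⟩
  · simpa using h (c, 0)
  · simpa using h (0, c)

/-- The values at pairs of codewords of the norm form of the quadratic extension of `𝔽₂`. -/
theorem normSq_sum_char_norm_form [Fintype F] (h2 : (2 : F) = 0) {χ : AddChar F ℂ}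
    (hχ : ∀ x, χ x = 1 → x = 0) (C : Submodule F (Fin n → F)) [Fintype C] :
    ‖∑ v : C × C, χ (∑ i, ((v.1 : Fin n → F) i ^ 2 +
        (v.1 : Fin n → F) i * (v.2 : Fin n → F) i + (v.2 : Fin n → F) i ^ 2))‖ ^ 2 =
      ((Fintype.card F : ℝ) ^ (dimCode C + dimCode (hull C))) ^ 2 := by
  have hb : ∀ d : C × C, pairingChar₂ χ C d.2 d.1 = 0 ↔
      (d.1 : Fin n → F) ∈ hull C ∧ (d.2 : Fin n → F) ∈ hull C := by
    intro d
    rw [pairingChar₂_eq_zero_iff hχ]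
    exact ⟨fun h => ⟨⟨d.1.2, h.2⟩, ⟨d.2.2, h.1⟩⟩, fun h => ⟨h.2.2, h.1.2⟩⟩
  -- In characteristic 2 only the cross terms of the polarization survive, which is why the two
  -- components of `d` are swapped.
  rw [normSq_sum_quadratic _ (fun d : C × C => pairingChar₂ χ C d.2 d.1)]
  · rw [pow_add, Nat.card_prod, card_code,
      Nat.card_congr ((Equiv.subtypeEquivRight hb).trans (Equiv.subtypeProdEquivProd (p := fun d : C => (d : Fin n → F) ∈ hull C)
        (q := fun d : C => (d : Fin n → F) ∈ hull C))),
      Nat.card_prod, card_mem_hull]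
    push_cast
    ring
  · exact fun c => AddChar.norm_apply χ _
  · intro v d
    rw [pairingChar₂_apply, pairingChar_apply, pairingChar_apply, ← AddChar.map_add_eq_mul,
      ← AddChar.map_add_eq_mul, ← AddChar.map_add_eq_mul, ← Finset.sum_add_distrib,
      ← Finset.sum_add_distrib, ← Finset.sum_add_distrib]
    congr 1
    refine Finset.sum_congr rfl fun i _ => ?_
    simp only [Submodule.coe_add, Pi.add_apply, Prod.fst_add, Prod.snd_add]
    linear_combination ((v.1 : Fin n → F) i * (d.1 : Fin n → F) i +
      (v.2 : Fin n → F) i * (d.2 : Fin n → F) i) * h2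
  · intro d hd
    have hd' := (hb d).1 hd
    have e1 := sum_mul_eq_zero_of_mem_hull hd'.1 d.1.2
    have e2 := sum_mul_eq_zero_of_mem_hull hd'.1 d.2.2
    have e3 := sum_mul_eq_zero_of_mem_hull hd'.2 d.2.2
    simp only [sq, Finset.sum_add_distrib, e1, e2, e3, add_zero, AddChar.map_zero_eq_one]

end Hull

/-! ### Monomial equivalence over F_2 and F_3 -/

section Monomial

variable {F : Type*} [Field F] {n : ℕ}

/-- Distinct columns have disjoint supports, and the single nonzero entry of each column squares to
1. -/
theorem IsMonomialMatrix.transpose_mul_self {M : Matrix (Fin n) (Fin n) F}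
    (hM : IsMonomialMatrix M) (hF : ∀ a : F, a ≠ 0 → a ^ 2 = 1) : M.transpose * M = 1 := by
  ext i j
  rw [Matrix.mul_apply]
  simp only [Matrix.transpose_apply]
  by_cases hij : i = j
  · subst hij
    obtain ⟨k, hk, hu⟩ := hM.2 i
    rw [Finset.sum_eq_single k, ← sq, hF _ hk, Matrix.one_apply_eq]
    · intro l _ hl
      have : M l i = 0 := by_contra fun h => hl (hu l h)
      rw [this, zero_mul]
    · simp
  · rw [Matrix.one_apply_ne hij]
    refine Finset.sum_eq_zero fun k _ => ?_
    by_contra h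
    exact hij ((hM.1 k).unique (left_ne_zero_of_mul h) (right_ne_zero_of_mul h))

theorem dimCode_hull_map_of_transpose_mul_self {M : Matrix (Fin n) (Fin n) F}
    (hM : M.transpose * M = 1) (C : Submodule F (Fin n → F)) :
    dimCode (hull (C.map M.mulVecLin)) = dimCode (hull C) := by
  have hdot : ∀ x c : Fin n → F, ∑ i, M.mulVecLin x i * M.mulVecLin c i = ∑ i, x i * c i := by
    intro x c
    change M.mulVec x ⬝ᵥ M.mulVec c = x ⬝ᵥ c
    rw [Matrix.dotProduct_mulVec, ← Matrix.mulVec_transpose, Matrix.mulVec_mulVec, hM,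
      Matrix.one_mulVec]
  have hinj : Function.Injective M.mulVecLin := by
    intro x y h
    have := congrArg M.transpose.mulVec h
    simpa only [Matrix.mulVecLin_apply, Matrix.mulVec_mulVec, hM, Matrix.one_mulVec] using this
  have hmap : hull (C.map M.mulVecLin) = (hull C).map M.mulVecLin := by
    ext y
    constructor
    · rintro ⟨⟨x, hx, rfl⟩, h⟩
      exact ⟨x, ⟨hx, fun c hc => by rw [← hdot]; exact h _ ⟨c, hc, rfl⟩⟩, rfl⟩
    · rintro ⟨x, ⟨hx, h⟩, rfl⟩
      refine ⟨⟨x, hx, rfl⟩, ?_⟩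
      rintro _ ⟨c, hc, rfl⟩
      rw [hdot]
      exact h c hc
  rw [hmap]
  exact (Submodule.equivMapOfInjective _ hinj _).finrank_eq.symm

theorem MonomialEquivalent.dimCode_hull_eq (hF : ∀ a : F, a ≠ 0 → a ^ 2 = 1)
    {C₁ C₂ : Submodule F (Fin n → F)} (h : MonomialEquivalent C₁ C₂) :
    dimCode (hull C₁) = dimCode (hull C₂) := by
  obtain ⟨M, hM, rfl⟩ := h
  exact (dimCode_hull_map_of_transpose_mul_self (hM.transpose_mul_self hF) C₁).symm

end Monomial



/-! ### Recovering the dimension; transfer from integer evaluations -/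

section Recovery

variable {F : Type*} [Field F] {n : ℕ} {K : Type*} [CommRing K]

/-- At X = Y the factor (X - Y)^|J| kills every J except ∅, and C(∅) = C. -/
theorem aeval_extWeightEnum_one_one (C : Submodule F (Fin n → F)) (T : K) :
    MvPolynomial.aeval ![1, 1, T] (extWeightEnum C) = T ^ dimCode C := by
  rw [aeval_extWeightEnum, Finset.sum_eq_single ∅]
  · have : vanishingOn C ∅ = C := by
      ext c
      exact ⟨fun h => h.1, fun h => ⟨h, fun j hj => absurd hj (Finset.notMem_empty j)⟩⟩
    rw [this]
    simp [dimCode]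
  · intro J _ hJ
    simp [hJ]
  · simp

theorem addChar_map_sum {A ι : Type*} [AddCommMonoid A] (χ : AddChar A K) (s : Finset ι)
    (f : ι → A) : χ (∑ i ∈ s, f i) = ∏ i ∈ s, χ (f i) := by
  classical
  induction s using Finset.induction_on with
  | empty => simp
  | insert i s hi ih => rw [Finset.sum_insert hi, Finset.prod_insert hi, AddChar.map_add_eq_mul, ih]

theorem intCast_eval {σ : Type*} (p : MvPolynomial σ ℤ) (v : σ → ℤ) :
    ((MvPolynomial.eval v p : ℤ) : K) = MvPolynomial.aeval (fun i => (v i : K)) p := by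
  have h := MvPolynomial.aeval_algebraMap_apply (A := ℤ) K v p
  exact h.symm

end Recovery

/-! ### Binary codes -/

section Binary

variable {F : Type*} [Field F] {n : ℕ}

theorem eq_one_of_card_eq_two [Fintype F] (hF : Fintype.card F = 2) {a : F} (ha : a ≠ 0) : a = 1 := by
  have h := FiniteField.pow_card_sub_one_eq_one a ha
  rwa [hF, pow_one] at h

theorem two_eq_zero_of_card_eq_two [Fintype F] (hF : Fintype.card F = 2) : (2 : F) = 0 := by
  have h := Nat.cast_card_eq_zero F
  rw [hF] at h
  exact_mod_cast h

theorem norm_aeval_extWeightEnum_of_card_eq_two [Fintype F] (hF : Fintype.card F = 2)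
    (C : Submodule F (Fin n → F)) :
    ‖MvPolynomial.aeval ![(1 : ℂ), -1, 4] (extWeightEnum C)‖ =
      2 ^ (dimCode C + dimCode (hull C)) := by
  classical
  have : Fintype C := Fintype.ofFinite C
  obtain ⟨χ, hχ1, hχ⟩ := exists_addChar_of_card_prime Nat.prime_two hF
    (IsPrimitiveRoot.neg_one 0 two_ne_zero.symm : IsPrimitiveRoot (-1 : ℂ) 2)
  have h2 := two_eq_zero_of_card_eq_two hF
  -- The form is anisotropic over F_2, so each position where the pair is not (0, 0) contributes a
  -- factor -1, the value of Y.
  have hval : ∀ a b : F, χ (a ^ 2 + a * b + b ^ 2) = if a = 0 ∧ b = 0 then 1 else -1 := by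
    intro a b
    by_cases ha : a = 0
    · by_cases hb : b = 0
      · simp [ha, hb]
      · simp [ha, eq_one_of_card_eq_two hF hb, hχ1]
    · by_cases hb : b = 0
      · simp [hb, eq_one_of_card_eq_two hF ha, hχ1]
      · rw [eq_one_of_card_eq_two hF ha, eq_one_of_card_eq_two hF hb,
          show (1 : F) ^ 2 + 1 * 1 + 1 ^ 2 = 1 by linear_combination h2, hχ1]
        simp
  have hsum : MvPolynomial.aeval ![(1 : ℂ), -1, 4] (extWeightEnum C) =
      ∑ v : C × C, χ (∑ i, ((v.1 : Fin n → F) i ^ 2 +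
        (v.1 : Fin n → F) i * (v.2 : Fin n → F) i + (v.2 : Fin n → F) i ^ 2)) := by
    have h := sum_card_vanishing_mul (fun v : C × C => Finset.univ.filter fun i =>
      (v.1 : Fin n → F) i = 0 ∧ (v.2 : Fin n → F) i = 0) (1 : ℂ) (-1)
    rw [aeval_extWeightEnum]
    trans
    · trans
      swap
      · exact h
      refine Finset.sum_congr rfl fun J _ => ?_
      have h4 : (4 : ℂ) = ((Fintype.card F ^ 2 : ℕ) : ℂ) := by rw [hF]; norm_num
      rw [h4, ← Nat.cast_pow, ← card_vanishingOn_sq, Nat.card_eq_fintype_card,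
        Fintype.card_subtype]
      simp only [Finset.subset_iff, Finset.mem_filter, Finset.mem_univ, true_and]
    · refine Finset.sum_congr rfl fun v _ => ?_
      rw [addChar_map_sum]
      simp only [hval]
      rw [Finset.prod_ite, Finset.prod_const_one, Finset.prod_const, one_pow]
      congr 2
      have := Finset.card_filter_add_card_filter_not (s := (Finset.univ : Finset (Fin n)))
        (fun i => (v.1 : Fin n → F) i = 0 ∧ (v.2 : Fin n → F) i = 0)
      rw [Finset.card_univ, Fintype.card_fin] at this
      omega
  have hsq := normSq_sum_char_norm_form h2 hχ C
  rw [hsum]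
  rw [hF] at hsq
  exact_mod_cast (pow_left_inj₀ (norm_nonneg _) (by positivity) two_ne_zero).1 hsq

/-- Here X - Y = 2 produces 2^k, and the sign (-1)^(n-k) disappears in the norm. -/
theorem norm_aeval_extWeightEnum_eq_tuttePoly (C : Submodule F (Fin n → F)) :
    ‖MvPolynomial.aeval ![(1 : ℂ), -1, 4] (extWeightEnum C)‖ =
      2 ^ dimCode C * ‖MvPolynomial.aeval ![(-1 : ℂ), -1] (tuttePoly (codeMatroid C))‖ := by
  rw [aeval_extWeightEnum_eq_tuttePoly C (1 : ℂ) (-1) 4 (by norm_num) (by norm_num),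
    show ((1 : ℂ) + (4 - 1) * -1) / (1 - -1) = -1 by norm_num,
    show (1 : ℂ) / -1 = -1 by norm_num, show (1 : ℂ) - -1 = 2 by norm_num]
  simp

theorem abs_eval_extWeightEnum (C : Submodule F (Fin n → F)) :
    ((|MvPolynomial.eval ![1, -1, 4] (extWeightEnum C)| : ℤ) : ℝ) =
      ‖MvPolynomial.aeval ![(1 : ℂ), -1, 4] (extWeightEnum C)‖ := by
  rw [Int.cast_abs, ← Complex.norm_intCast, intCast_eval]
  congr 3
  ext i
  fin_cases i <;> simp

theorem abs_eval_tuttePoly (C : Submodule F (Fin n → F)) :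
    ((|MvPolynomial.eval ![-1, -1] (tuttePoly (codeMatroid C))| : ℤ) : ℝ) =
      ‖MvPolynomial.aeval ![(-1 : ℂ), -1] (tuttePoly (codeMatroid C))‖ := by
  rw [Int.cast_abs, ← Complex.norm_intCast, intCast_eval]
  congr 3
  ext i
  fin_cases i <;> simp

theorem dimCode_hull_eq_of_extWeightEnum_eq_of_card_eq_two [Fintype F] (hF : Fintype.card F = 2)
    {n₁ n₂ : ℕ} {C₁ : Submodule F (Fin n₁ → F)} {C₂ : Submodule F (Fin n₂ → F)}
    (h : extWeightEnum C₁ = extWeightEnum C₂) : dimCode (hull C₁) = dimCode (hull C₂) := by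
  have e1 := aeval_extWeightEnum_one_one C₁ (2 : ℤ)
  have e2 := norm_aeval_extWeightEnum_of_card_eq_two hF C₁
  rw [h, aeval_extWeightEnum_one_one] at e1
  rw [h, norm_aeval_extWeightEnum_of_card_eq_two hF] at e2
  have f1 := pow_right_injective₀ (by norm_num : (0 : ℤ) < 2) (by norm_num) e1
  have f2 := pow_right_injective₀ (by norm_num : (0 : ℝ) < 2) (by norm_num) e2
  omega

end Binary

/-! ### Ternary codes -/

section Ternary

variable {F : Type*} [Field F] {n : ℕ}

theorem sq_eq_one_of_card_eq_three [Fintype F] (hF : Fintype.card F = 3) {a : F} (ha : a ≠ 0) :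
    a ^ 2 = 1 := by
  have h := FiniteField.pow_card_sub_one_eq_one a ha
  rwa [hF] at h

theorem two_ne_zero_of_card_eq_three [Fintype F] (hF : Fintype.card F = 3) : (2 : F) ≠ 0 := by
  intro h2
  have h := Nat.cast_card_eq_zero F
  rw [hF] at h
  push_cast at h
  exact one_ne_zero (α := F) (by linear_combination h - h2)

variable [DecidableEq F]

theorem norm_aeval_weightEnum_of_card_eq_three [Fintype F] (hF : Fintype.card F = 3)
    (C : Submodule F (Fin n → F)) {j : ℂ} (hj : IsPrimitiveRoot j 3) :
    ‖MvPolynomial.aeval ![1, j] (weightEnum C)‖ = √3 ^ (dimCode C + dimCode (hull C)) := by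
  have : Fintype C := Fintype.ofFinite C
  obtain ⟨χ, hχ1, hχ⟩ := exists_addChar_of_card_prime Nat.prime_three hF hj
  -- Hence χ(∑ cᵢ²) = j^wt(c), and the weight enumerator at (1, j) is a Gauss sum.
  have hval : ∀ a : F, χ (a ^ 2) = if a = 0 then 1 else j := by
    intro a
    by_cases ha : a = 0
    · simp [ha]
    · rw [sq_eq_one_of_card_eq_three hF ha, hχ1, if_neg ha]
  have hsum : MvPolynomial.aeval ![1, j] (weightEnum C) =
      ∑ c : C, χ (∑ i, (c : Fin n → F) i ^ 2) := by
    rw [aeval_weightEnum]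
    refine Finset.sum_congr rfl fun c _ => ?_
    rw [addChar_map_sum]
    simp only [hval]
    rw [Finset.prod_ite, Finset.prod_const_one, Finset.prod_const, one_pow]
    rfl
  have hsq := normSq_sum_char_sq (two_ne_zero_of_card_eq_three hF) hχ C
  rw [← hsum, hF] at hsq
  rw [← pow_left_inj₀ (norm_nonneg _) (by positivity) two_ne_zero, hsq, pow_right_comm,
    Real.sq_sqrt (by norm_num)]
  norm_num

theorem dimCode_hull_eq_of_weightEnum_eq_of_card_eq_three [Fintype F] (hF : Fintype.card F = 3)
    {n₁ n₂ : ℕ} {C₁ : Submodule F (Fin n₁ → F)} {C₂ : Submodule F (Fin n₂ → F)}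
    (h : weightEnum C₁ = weightEnum C₂) : dimCode (hull C₁) = dimCode (hull C₂) := by
  have hj := Complex.isPrimitiveRoot_exp 3 (by norm_num)
  have e1 := aeval_extWeightEnum_one_one C₁ (Fintype.card F : ℤ)
  have e2 := norm_aeval_weightEnum_of_card_eq_three hF C₁ hj
  -- The ordinary weight enumerator already knows k: its value at (1, 1) is the extended one at T =
  -- 3, that is 3^k.
  rw [aeval_extWeightEnum_card, h, ← aeval_extWeightEnum_card, aeval_extWeightEnum_one_one,
    hF] at e1
  rw [h, norm_aeval_weightEnum_of_card_eq_three hF _ hj] at e2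
  have f1 := pow_right_injective₀ (by norm_num : (0 : ℤ) < (3 : ℕ)) (by norm_num) e1
  have h1 : 1 < √(3 : ℝ) := by rw [Real.lt_sqrt] <;> norm_num
  have f2 := pow_right_injective₀ (by positivity : (0 : ℝ) < √3) h1.ne' e2
  omega

theorem dimCode_hull_eq_of_extWeightEnum_eq_of_card_eq_three [Fintype F] (hF : Fintype.card F = 3)
    {n₁ n₂ : ℕ} {C₁ : Submodule F (Fin n₁ → F)} {C₂ : Submodule F (Fin n₂ → F)}
    (h : extWeightEnum C₁ = extWeightEnum C₂) : dimCode (hull C₁) = dimCode (hull C₂) := by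
  have hj := Complex.isPrimitiveRoot_exp 3 (by norm_num)
  have e1 := aeval_extWeightEnum_one_one C₁ (3 : ℤ)
  have e2 := norm_aeval_weightEnum_of_card_eq_three hF C₁ hj
  rw [h, aeval_extWeightEnum_one_one] at e1
  rw [← aeval_extWeightEnum_card, h, aeval_extWeightEnum_card,
    norm_aeval_weightEnum_of_card_eq_three hF _ hj] at e2
  have f1 := pow_right_injective₀ (by norm_num : (0 : ℤ) < 3) (by norm_num) e1
  have h1 : 1 < √(3 : ℝ) := by rw [Real.lt_sqrt] <;> norm_num
  have f2 := pow_right_injective₀ (by positivity : (0 : ℝ) < √3) h1.ne' e2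
  omega

theorem sq_add_self_add_one_of_primitive {j : ℂ} (hj : IsPrimitiveRoot j 3) :
    j ^ 2 + j + 1 = 0 := by
  have h := hj.geom_sum_eq_zero (by norm_num)
  simp only [Finset.sum_range_succ, Finset.sum_range_zero] at h
  linear_combination h

/-- Conjugation sends j to j², so the squared norm is (j² - 1)(j - 1) = 3. -/
theorem norm_sq_sub_one_of_primitive {j : ℂ} (hj : IsPrimitiveRoot j 3) :
    ‖j ^ 2 - 1‖ = √3 := by
  have h3 := hj.pow_eq_one
  have h1 := sq_add_self_add_one_of_primitive hj
  have hc : (starRingEnd ℂ) j = j ^ 2 := by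
    have hn : ‖j‖ = 1 := hj.norm'_eq_one (by norm_num)
    have := Complex.mul_conj' j
    rw [hn] at this
    push_cast at this
    linear_combination j ^ 2 * this - (starRingEnd ℂ) j * h3
  have h := Complex.mul_conj' (j ^ 2 - 1)
  rw [map_sub, map_pow, map_one, hc] at h
  have h' : ((‖j ^ 2 - 1‖ ^ 2 : ℝ) : ℂ) = (3 : ℝ) := by
    push_cast
    rw [← h]
    linear_combination (j ^ 3 - j + 1) * h3 - h1
  rw [← Real.sqrt_sq (norm_nonneg (j ^ 2 - 1)), Complex.ofReal_injective h']

/-- The point (j, j²) lies on the curve (x - 1)(y - 1) = 3 = q, where the extended enumerator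
reduces to the ordinary one. -/
theorem aeval_tuttePoly_of_card_eq_three [Fintype F] (hF : Fintype.card F = 3)
    (C : Submodule F (Fin n → F)) {j : ℂ} (hj : IsPrimitiveRoot j 3) :
    MvPolynomial.aeval ![j, j ^ 2] (tuttePoly (codeMatroid C)) =
      j ^ (2 * n) * ((j ^ 2 - 1) ^ dimCode C)⁻¹ *
        MvPolynomial.aeval ![1, j] (weightEnum C) := by
  have h3 := hj.pow_eq_one
  have h1 := sq_add_self_add_one_of_primitive hj
  have h0 : j ≠ 0 := hj.ne_zero (by norm_num)
  rw [aeval_tuttePoly_eq_extWeightEnum C j (j ^ 2) (pow_ne_zero _ h0)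
    (hj.pow_ne_one_of_pos_of_lt (by norm_num) (by norm_num)), ← pow_mul,
    show (j ^ 2)⁻¹ = j by field_simp; linear_combination -h3,
    show (j - 1) * (j ^ 2 - 1) = (Fintype.card F : ℂ) by
      rw [hF]; push_cast; linear_combination h3 - h1, aeval_extWeightEnum_card]

theorem norm_aeval_tuttePoly_of_card_eq_three [Fintype F] (hF : Fintype.card F = 3)
    (C : Submodule F (Fin n → F)) {j : ℂ} (hj : IsPrimitiveRoot j 3) :
    ‖MvPolynomial.aeval ![j, j ^ 2] (tuttePoly (codeMatroid C))‖ = √3 ^ dimCode (hull C) := by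
  have hn : ‖j‖ = 1 := hj.norm'_eq_one (by norm_num)
  rw [aeval_tuttePoly_of_card_eq_three hF C hj, norm_mul, norm_mul, norm_inv, norm_pow, norm_pow,
    norm_sq_sub_one_of_primitive hj, hn, norm_aeval_weightEnum_of_card_eq_three hF C hj, one_pow,
    one_mul, pow_add, inv_mul_cancel_left₀ (by positivity)]

theorem weightDist_eq_zero_of_lt (C : Submodule F (Fin n → F)) {w : ℕ} (hw : n < w) :
    weightDist C w = 0 := by
  rw [weightDist]
  convert Set.ncard_empty (Fin n → F)
  ext c
  simp only [Set.mem_ofPred_eq, Set.mem_empty_iff_false, iff_false, not_and]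
  rintro - h
  have := hammingNorm_le_card_fintype (x := c)
  rw [Fintype.card_fin] at this
  omega

theorem sum_range_three_mul {M : Type*} [AddCommMonoid M] (f : ℕ → M) (m : ℕ) :
    ∑ w ∈ Finset.range (3 * m), f w = ∑ i ∈ Finset.range m, f (3 * i) +
      ∑ i ∈ Finset.range m, f (3 * i + 1) + ∑ i ∈ Finset.range m, f (3 * i + 2) := by
  induction m with
  | zero => simp
  | succ m ih =>
    rw [show 3 * (m + 1) = 3 * m + 1 + 1 + 1 by ring, Finset.sum_range_succ,
      Finset.sum_range_succ, Finset.sum_range_succ, ih]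
    simp only [Finset.sum_range_succ]
    abel

theorem aeval_weightEnum_one_primitive (C : Submodule F (Fin n → F)) {j : ℂ}
    (hj : IsPrimitiveRoot j 3) :
    MvPolynomial.aeval ![1, j] (weightEnum C) =
      ((∑ i ∈ Finset.range (n / 3 + 1), weightDist C (3 * i) : ℕ) : ℂ) +
      ((∑ i ∈ Finset.range (n / 3 + 1), weightDist C (3 * i + 1) : ℕ) : ℂ) * j +
      ((∑ i ∈ Finset.range (n / 3 + 1), weightDist C (3 * i + 2) : ℕ) : ℂ) * j ^ 2 := by
  have h3 := hj.pow_eq_one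
  have h : MvPolynomial.aeval ![1, j] (weightEnum C) =
      ∑ w ∈ Finset.range (3 * (n / 3 + 1)), (weightDist C w : ℂ) * j ^ w := by
    simp only [weightEnum, map_sum, map_mul, map_pow, map_natCast, one_pow, mul_one,
      MvPolynomial.aeval_X, Matrix.cons_val_zero, Matrix.cons_val_one]
    -- The range is padded from n + 1 to a multiple of 3; the added weights exceed n and contribute
    -- 0.
    apply Finset.sum_subset
    · exact Finset.range_subset_range.2 (by omega)
    · intro w _ hw
      rw [weightDist_eq_zero_of_lt C (by simpa using hw), Nat.cast_zero, zero_mul]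
  rw [h, sum_range_three_mul]
  simp only [pow_add, pow_mul, h3, one_pow, one_mul, mul_one, pow_one, Nat.cast_sum,
    Finset.sum_mul]

end Ternary

end HullCode
theorem mainTheorem3 (F : Type*) [Field F] [Fintype F] [DecidableEq F] :
    -- relations between the weight enumerators and the Tutte polynomial, over any finite field
    (∀ (n : ℕ) (C : Submodule F (Fin n → F)) (K : Type*) [Field K],
      (∀ x y : K,
        MvPolynomial.aeval ![x, y, (Fintype.card F : K)] (HullCode.extWeightEnum C) =
          MvPolynomial.aeval ![x, y] (HullCode.weightEnum C)) ∧
      (∀ x y T : K, x ≠ y → y ≠ 0 →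
        MvPolynomial.aeval ![x, y, T] (HullCode.extWeightEnum C) =
          (x - y) ^ HullCode.dimCode C * y ^ (n - HullCode.dimCode C) *
            MvPolynomial.aeval ![(x + (T - 1) * y) / (x - y), x / y]
              (HullCode.tuttePoly (HullCode.codeMatroid C))) ∧
      (∀ x y : K, y ≠ 0 → y ≠ 1 →
        MvPolynomial.aeval ![x, y] (HullCode.tuttePoly (HullCode.codeMatroid C)) =
          y ^ n * ((y - 1) ^ HullCode.dimCode C)⁻¹ *
            MvPolynomial.aeval ![1, y⁻¹, (x - 1) * (y - 1)] (HullCode.extWeightEnum C))) ∧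
    -- the binary case
    (Fintype.card F = 2 →
      (∀ (n : ℕ) (C₁ C₂ : Submodule F (Fin n → F)), HullCode.MonomialEquivalent C₁ C₂ →
        HullCode.dimCode (HullCode.hull C₁) = HullCode.dimCode (HullCode.hull C₂)) ∧
      (∀ (n₁ n₂ : ℕ) (C₁ : Submodule F (Fin n₁ → F)) (C₂ : Submodule F (Fin n₂ → F)),
        HullCode.extWeightEnum C₁ = HullCode.extWeightEnum C₂ →
        HullCode.dimCode (HullCode.hull C₁) = HullCode.dimCode (HullCode.hull C₂)) ∧
      (∀ (n : ℕ) (C : Submodule F (Fin n → F)),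
        |MvPolynomial.eval ![-1, -1] (HullCode.tuttePoly (HullCode.codeMatroid C))| =
          2 ^ HullCode.dimCode (HullCode.hull C) ∧
        |MvPolynomial.eval ![1, -1, 4] (HullCode.extWeightEnum C)| =
          2 ^ HullCode.dimCode C *
            |MvPolynomial.eval ![-1, -1] (HullCode.tuttePoly (HullCode.codeMatroid C))| ∧
        |MvPolynomial.eval ![1, -1, 4] (HullCode.extWeightEnum C)| =
          2 ^ (HullCode.dimCode C + HullCode.dimCode (HullCode.hull C)))) ∧
    -- the ternary case
    (Fintype.card F = 3 →
      (∀ (n : ℕ) (C₁ C₂ : Submodule F (Fin n → F)), HullCode.MonomialEquivalent C₁ C₂ →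
        HullCode.dimCode (HullCode.hull C₁) = HullCode.dimCode (HullCode.hull C₂)) ∧
      (∀ (n₁ n₂ : ℕ) (C₁ : Submodule F (Fin n₁ → F)) (C₂ : Submodule F (Fin n₂ → F)),
        HullCode.extWeightEnum C₁ = HullCode.extWeightEnum C₂ →
        HullCode.dimCode (HullCode.hull C₁) = HullCode.dimCode (HullCode.hull C₂)) ∧
      (∀ (n₁ n₂ : ℕ) (C₁ : Submodule F (Fin n₁ → F)) (C₂ : Submodule F (Fin n₂ → F)),
        HullCode.weightEnum C₁ = HullCode.weightEnum C₂ →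
        HullCode.dimCode (HullCode.hull C₁) = HullCode.dimCode (HullCode.hull C₂)) ∧
      (∀ (n : ℕ) (C : Submodule F (Fin n → F)) (j : ℂ), IsPrimitiveRoot j 3 →
        ‖MvPolynomial.aeval ![j, j ^ 2] (HullCode.tuttePoly (HullCode.codeMatroid C))‖ =
          √3 ^ HullCode.dimCode (HullCode.hull C) ∧
        MvPolynomial.aeval ![j, j ^ 2] (HullCode.tuttePoly (HullCode.codeMatroid C)) =
          j ^ (2 * n) * ((j ^ 2 - 1) ^ HullCode.dimCode C)⁻¹ *
            MvPolynomial.aeval ![1, j] (HullCode.weightEnum C) ∧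
        ‖MvPolynomial.aeval ![1, j] (HullCode.weightEnum C)‖ =
          √3 ^ (HullCode.dimCode C + HullCode.dimCode (HullCode.hull C)) ∧
        MvPolynomial.aeval ![1, j] (HullCode.weightEnum C) =
          ((∑ i ∈ Finset.range (n / 3 + 1), HullCode.weightDist C (3 * i) : ℕ) : ℂ) +
          ((∑ i ∈ Finset.range (n / 3 + 1), HullCode.weightDist C (3 * i + 1) : ℕ) : ℂ) * j +
          ((∑ i ∈ Finset.range (n / 3 + 1), HullCode.weightDist C (3 * i + 2) : ℕ) : ℂ) *
            j ^ 2)) := by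

  refine ⟨fun n C K _ => ⟨HullCode.aeval_extWeightEnum_card C,
    HullCode.aeval_extWeightEnum_eq_tuttePoly C, HullCode.aeval_tuttePoly_eq_extWeightEnum C⟩,
    fun hF => ⟨fun n C₁ C₂ h => ?_, fun n₁ n₂ C₁ C₂ h => ?_, fun n C => ?_⟩,
    fun hF => ⟨fun n C₁ C₂ h => ?_, fun n₁ n₂ C₁ C₂ h => ?_, fun n₁ n₂ C₁ C₂ h => ?_,
      fun n C j hj => ⟨?_, ?_, ?_, ?_⟩⟩⟩
  · exact h.dimCode_hull_eq fun a ha => by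
      rw [HullCode.eq_one_of_card_eq_two hF ha, one_pow]
  · exact HullCode.dimCode_hull_eq_of_extWeightEnum_eq_of_card_eq_two hF h
  · have h1 := HullCode.norm_aeval_extWeightEnum_of_card_eq_two hF C
    have h2 := HullCode.norm_aeval_extWeightEnum_eq_tuttePoly C
    rw [← HullCode.abs_eval_extWeightEnum] at h1 h2
    rw [← HullCode.abs_eval_tuttePoly] at h2
    have h1' : |MvPolynomial.eval ![1, -1, 4] (HullCode.extWeightEnum C)| =
        2 ^ (HullCode.dimCode C + HullCode.dimCode (HullCode.hull C)) := by exact_mod_cast h1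
    have h2' : |MvPolynomial.eval ![1, -1, 4] (HullCode.extWeightEnum C)| =
        2 ^ HullCode.dimCode C *
          |MvPolynomial.eval ![-1, -1] (HullCode.tuttePoly (HullCode.codeMatroid C))| := by
      exact_mod_cast h2
    refine ⟨?_, h2', h1'⟩
    -- Cancelling 2^k between the two evaluations leaves |t_C(-1, -1)| = 2^h.
    rw [h1', pow_add] at h2'
    exact (mul_left_cancel₀ (by positivity) h2').symm
  · exact h.dimCode_hull_eq fun a ha => HullCode.sq_eq_one_of_card_eq_three hF ha
  · exact HullCode.dimCode_hull_eq_of_extWeightEnum_eq_of_card_eq_three hF h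
  · exact HullCode.dimCode_hull_eq_of_weightEnum_eq_of_card_eq_three hF h
  · exact HullCode.norm_aeval_tuttePoly_of_card_eq_three hF C hj
  · exact HullCode.aeval_tuttePoly_of_card_eq_three hF C hj
  · exact HullCode.norm_aeval_weightEnum_of_card_eq_three hF C hj
  · exact HullCode.aeval_weightEnum_one_primitive C hj
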